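/- Let $d$ be a nonnegative integer and let $A,B$ be symmetric positive definite real $d\times d$ matrices. Let $\eta_1,\dots,\eta_d$ be the eigenvalues, counted with multiplicity, of $B^{-1/2}AB^{-1/2}$, where $B^{-1/2}$ is the inverse of the positive definite square root of $B$, and let $$D(A,B)=\sum_{j=1}^d\bigl(\eta_j-1-\log\eta_j\bigr).$$ (More generally, for positive semidefinite $A$ the same formula defines $D(A,B)\in[0,+\infty]$, with the convention $0-1-\log 0=+\infty$.) Let $X\sim N(0,A)$ and $Y\sim N(0,B)$ be $d$-variate random vectors, with densities $f_X$ and $f_Y$, and let $$\mathrm{KL}_{\mathrm{std}}(X,Y)=\int f_X\log\frac{f_X}{f_Y}$$ be the standard Kullback–Leibler divergence (natural logarithm) of the law of $X$ from the law of $Y$. Then $$D(A,B)=2\,\mathrm{KL}_{\mathrm{std}}(X,Y).$$ That is, $D(A,B)$ coincides with the Kullback–Leibler divergence $\mathrm{KL}(X,Y)$ in the normalization $\mathrm{KL}=2\,\mathrm{KL}_{\mathrm{std}}$, in which the factor $\tfrac12$ of the standard Gaussian formula is absent. -/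

import Mathlib

open MeasureTheory ProbabilityTheory InformationTheory
open scoped MatrixOrder

noncomputable section

namespace ScatterDiscrepancy

/-- The matrix `B^{-1/2}`: for positive definite `B`, the inverse of its positive definite square
root. -/
def invSqrt {d : ℕ} (B : Matrix (Fin d) (Fin d) ℝ) : Matrix (Fin d) (Fin d) ℝ :=
  (CFC.sqrt B)⁻¹

lemma invSqrt_isHermitian {d : ℕ} (B : Matrix (Fin d) (Fin d) ℝ) : (invSqrt B).IsHermitian :=
  (Matrix.nonneg_iff_posSemidef.mp (CFC.sqrt_nonneg B)).isHermitian.inv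

/-- The matrix `C = B^{-1/2} A B^{-1/2}`, the scatter `A` in the coordinates in which `B` is
whitened. -/
def whitened {d : ℕ} (A B : Matrix (Fin d) (Fin d) ℝ) : Matrix (Fin d) (Fin d) ℝ :=
  invSqrt B * A * invSqrt B

lemma whitened_isHermitian {d : ℕ} {A : Matrix (Fin d) (Fin d) ℝ} (hA : A.PosSemidef)
    (B : Matrix (Fin d) (Fin d) ℝ) : (whitened A B).IsHermitian := by
  have h := Matrix.isHermitian_mul_mul_conjTranspose (invSqrt B) hA.isHermitian
  rwa [(invSqrt_isHermitian B).eq] at h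

/-- The function `h(η) = η - 1 - log η` on `η ≥ 0`, with the limit value `h(0) = +∞`. (It is only
ever used at `η ≥ 0`.) -/
def h (η : ℝ) : EReal :=
  if 0 < η then ((η - 1 - Real.log η : ℝ) : EReal) else ⊤

/-- The discrepancy `D(A, B) = ∑_j h(η_j)` of a positive semidefinite matrix `A` relative to a
positive definite matrix `B`, where the `η_j` are the eigenvalues, with multiplicity, of
`B^{-1/2} A B^{-1/2}`. -/
def discrepancy {d : ℕ} (A B : Matrix (Fin d) (Fin d) ℝ) (hA : A.PosSemidef) (_hB : B.PosDef) :
    EReal :=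
  ∑ j : Fin d, h ((whitened_isHermitian hA B).eigenvalues j)

end ScatterDiscrepancy

end

/-!
Both sides are invariant under congruence: with `T = B^{1/2} U`, where `U` diagonalizes
`B^{-1/2} A B^{-1/2}`, one has `A = T diag(η) Tᵀ` and `B = T Tᵀ`, so the linear isomorphism `T`
reduces the divergence to that of `N(m, diag(η))` from `N(m, 1)`. These are product measures, and
by the chain rule the divergence is the sum of the one-dimensional ones, each equal to `h(η_j) / 2`.
At `η_j = 0` both are infinite, a Dirac mass being singular to a nondegenerate Gaussian.
-/

namespace ScatterDiscrepancy

section KullbackLeibler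

variable {α β : Type*} [MeasurableSpace α] [MeasurableSpace β]

lemma klDiv_map_measurableEquiv (μ ν : Measure α) [IsFiniteMeasure μ] [IsFiniteMeasure ν]
    (e : α ≃ᵐ β) : klDiv (μ.map e) (ν.map e) = klDiv μ ν := by
  refine le_antisymm (klDiv_map_le μ ν e.measurable) ?_
  simpa only [e.map_symm_map] using klDiv_map_le (μ.map e) (ν.map e) e.symm.measurable

lemma klDiv_prod_right (μ ν : Measure α) [IsFiniteMeasure μ] [IsFiniteMeasure ν]
    (ρ : Measure β) [IsProbabilityMeasure ρ] : klDiv (μ.prod ρ) (ν.prod ρ) = klDiv μ ν := by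
  simpa only [Measure.compProd_const] using klDiv_compProd_left μ ν (Kernel.const α ρ)

lemma klDiv_prod_left (ρ : Measure α) [IsProbabilityMeasure ρ]
    (μ ν : Measure β) [IsFiniteMeasure μ] [IsFiniteMeasure ν] :
    klDiv (ρ.prod μ) (ρ.prod ν) = klDiv μ ν := by
  rw [← klDiv_map_measurableEquiv _ _ MeasurableEquiv.prodComm]
  exact (congrArg₂ klDiv Measure.prod_swap Measure.prod_swap).trans (klDiv_prod_right μ ν ρ)

lemma klDiv_prod (μ₁ ν₁ : Measure α) (μ₂ ν₂ : Measure β) [IsProbabilityMeasure μ₁]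
    [IsFiniteMeasure ν₁] [IsProbabilityMeasure μ₂] [IsProbabilityMeasure ν₂] :
    klDiv (μ₁.prod μ₂) (ν₁.prod ν₂) = klDiv μ₁ ν₁ + klDiv μ₂ ν₂ := by
  have chain := klDiv_compProd_eq_add μ₁ ν₁ (Kernel.const α μ₂) (Kernel.const α ν₂)
  simpa only [Measure.compProd_const, klDiv_prod_left] using chain

lemma klDiv_pi {ι : Type*} [Fintype ι] {X : ι → Type*} [∀ i, MeasurableSpace (X i)]
    (μ ν : ∀ i, Measure (X i)) [∀ i, IsProbabilityMeasure (μ i)]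
    [∀ i, IsProbabilityMeasure (ν i)] :
    klDiv (Measure.pi μ) (Measure.pi ν) = ∑ i, klDiv (μ i) (ν i) := by
  refine Fintype.induction_empty_option (P := fun ι _ ↦ ∀ (X : ι → Type _)
    [∀ i, MeasurableSpace (X i)] (μ ν : ∀ i, Measure (X i)) [∀ i, IsProbabilityMeasure (μ i)]
    [∀ i, IsProbabilityMeasure (ν i)],
    klDiv (Measure.pi μ) (Measure.pi ν) = ∑ i, klDiv (μ i) (ν i)) ?_ ?_ ?_ ι X μ ν
  · intro ι κ _ e ih X _ μ ν _ _
    let := Fintype.ofEquiv κ e.symm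
    rw [← e.sum_comp, ← ih _ (fun i ↦ μ (e i)) (fun i ↦ ν (e i)),
      ← (measurePreserving_piCongrLeft μ e).map_eq, ← (measurePreserving_piCongrLeft ν e).map_eq,
      klDiv_map_measurableEquiv]
  · intro X _ μ ν _ _
    rw [Measure.pi_of_empty, Measure.pi_of_empty, klDiv_self, Fintype.sum_empty]
  · intro ι _ ih X _ μ ν _ _
    rw [← Measure.pi_map_piOptionEquivProd μ, ← Measure.pi_map_piOptionEquivProd ν,
      klDiv_map_measurableEquiv, klDiv_prod, ih, Fintype.sum_option, add_comm]

end KullbackLeibler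

lemma integral_sub_const_sq {Ω : Type*} [MeasurableSpace Ω] {μ : Measure Ω}
    [IsProbabilityMeasure μ] {X : Ω → ℝ} (hX : MemLp X 2 μ) (c : ℝ) :
    ∫ ω, (X ω - c) ^ 2 ∂μ = Var[X; μ] + (μ[X] - c) ^ 2 := by
  have hvar := variance_eq_sub (hX.sub (memLp_const c))
  have hmean : ∫ ω, (X ω - c) ∂μ = μ[X] - c := by
    rw [integral_sub (hX.integrable one_le_two) (integrable_const c), integral_const,
      probReal_univ, one_smul]
  rw [← hmean, ← variance_sub_const hX.aestronglyMeasurable c]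
  exact eq_add_of_sub_eq hvar.symm

section RealGaussian

open Real
open scoped NNReal

lemma log_gaussianPDFReal (m : ℝ) {v : ℝ≥0} (hv : v ≠ 0) (x : ℝ) :
    log (gaussianPDFReal m v x) = -(log (2 * π) + log v) / 2 - (x - m) ^ 2 / (2 * v) := by
  rw [gaussianPDFReal, log_mul (by positivity) (by positivity), log_exp, log_inv,
    log_sqrt (by positivity), log_mul (by positivity) (by positivity)]
  ring

lemma llr_gaussianReal (m₁ m₂ : ℝ) {v₁ v₂ : ℝ≥0} (hv₁ : v₁ ≠ 0) (hv₂ : v₂ ≠ 0) :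
    llr (gaussianReal m₁ v₁) (gaussianReal m₂ v₂) =ᵐ[gaussianReal m₁ v₁] fun x ↦
      (x - m₂) ^ 2 / (2 * v₂) - (x - m₁) ^ 2 / (2 * v₁) - (log v₁ - log v₂) / 2 := by
  have ac₁ := gaussianReal_absolutelyContinuous m₁ hv₁
  have ac₂ := gaussianReal_absolutelyContinuous m₂ hv₂
  have ac₁₂ := ac₁.trans (gaussianReal_absolutelyContinuous' m₂ hv₂)
  filter_upwards [ac₁₂.ae_le (Measure.rnDeriv_eq_div ac₁ ac₂),
    ac₁.ae_le (rnDeriv_gaussianReal m₁ v₁), ac₁.ae_le (rnDeriv_gaussianReal m₂ v₂)]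
    with x hx hx₁ hx₂
  simp only [llr_def]
  rw [hx, hx₁, hx₂, ENNReal.toReal_div, toReal_gaussianPDF, toReal_gaussianPDF,
    log_div (gaussianPDFReal_pos _ _ _ hv₁).ne' (gaussianPDFReal_pos _ _ _ hv₂).ne',
    log_gaussianPDFReal _ hv₁, log_gaussianPDFReal _ hv₂]
  ring

lemma klDiv_gaussianReal (m₁ m₂ : ℝ) {v₁ v₂ : ℝ≥0} (hv₁ : v₁ ≠ 0) (hv₂ : v₂ ≠ 0) :
    klDiv (gaussianReal m₁ v₁) (gaussianReal m₂ v₂) =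
      ENNReal.ofReal ((v₁ / v₂ - 1 - log (v₁ / v₂) + (m₁ - m₂) ^ 2 / v₂) / 2) := by
  have hac : gaussianReal m₁ v₁ ≪ gaussianReal m₂ v₂ :=
    (gaussianReal_absolutelyContinuous m₁ hv₁).trans (gaussianReal_absolutelyContinuous' m₂ hv₂)
  have hllr := llr_gaussianReal m₁ m₂ hv₁ hv₂
  have hid : MemLp (fun x ↦ x) 2 (gaussianReal m₁ v₁) := memLp_id_gaussianReal 2
  have hsq (c a : ℝ) : Integrable (fun x ↦ (x - c) ^ 2 / a) (gaussianReal m₁ v₁) :=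
    (hid.sub (memLp_const c)).integrable_sq.div_const a
  have hdiff : Integrable (fun x ↦ (x - m₂) ^ 2 / (2 * v₂) - (x - m₁) ^ 2 / (2 * v₁))
      (gaussianReal m₁ v₁) := (hsq m₂ _).sub (hsq m₁ _)
  have hint := (integrable_congr hllr).2 (hdiff.sub (integrable_const _))
  have hkl : ∫ x, llr (gaussianReal m₁ v₁) (gaussianReal m₂ v₂) x ∂gaussianReal m₁ v₁ =
      (v₁ + (m₁ - m₂) ^ 2) / (2 * v₂) - (v₁ + (m₁ - m₁) ^ 2) / (2 * v₁) -
        (log v₁ - log v₂) / 2 := by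
    rw [integral_congr_ae hllr, integral_sub hdiff (integrable_const _),
      integral_sub (hsq _ _) (hsq _ _), integral_div, integral_div, integral_sub_const_sq hid,
      integral_sub_const_sq hid, variance_fun_id_gaussianReal, integral_id_gaussianReal,
      integral_const, probReal_univ, one_smul]
  rw [klDiv_of_ac_of_integrable hac hint, probReal_univ, probReal_univ, add_sub_cancel_right, hkl,
    log_div (by positivity) (by positivity)]
  congr 1
  field_simp
  ring

lemma klDiv_gaussianReal_zero_var (m₁ m₂ : ℝ) {v : ℝ≥0} (hv : v ≠ 0) :
    klDiv (gaussianReal m₁ 0) (gaussianReal m₂ v) = ⊤ := by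
  have := nullSingletonClass_gaussianReal (μ := m₂) hv
  refine klDiv_of_not_ac fun hac ↦ ?_
  have hnull := hac (measure_singleton m₁)
  simp at hnull

lemma h_eq_two_mul_klDiv_gaussianReal (m : ℝ) {η : ℝ} (hη : 0 ≤ η) :
    h η = ((2 * klDiv (gaussianReal m η.toNNReal) (gaussianReal m 1) : ENNReal) : EReal) := by
  rcases hη.eq_or_lt with rfl | hpos
  · rw [h, if_neg (lt_irrefl 0), toNNReal_zero, klDiv_gaussianReal_zero_var m m one_ne_zero,
      ENNReal.mul_top two_ne_zero, EReal.coe_ennreal_top]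
  have hgibbs : 0 ≤ η - 1 - log η := sub_nonneg.2 (log_le_sub_one_of_pos hpos)
  rw [h, if_pos hpos, klDiv_gaussianReal m m (toNNReal_pos.2 hpos).ne' one_ne_zero,
    coe_toNNReal _ hη, ← ENNReal.ofReal_ofNat 2, ← ENNReal.ofReal_mul zero_le_two,
    EReal.coe_ennreal_ofReal]
  simp [mul_div_cancel₀, hgibbs]

end RealGaussian

section MultivariateGaussian

open Matrix
open scoped NNReal

variable {ι : Type*} [Fintype ι] [DecidableEq ι]

lemma map_toEuclideanCLM_multivariateGaussian (m : EuclideanSpace ℝ ι) {A : Matrix ι ι ℝ}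
    (hA : A.PosSemidef) (T : Matrix ι ι ℝ) :
    (multivariateGaussian m A).map (toEuclideanCLM (𝕜 := ℝ) T) =
      multivariateGaussian (toEuclideanCLM (𝕜 := ℝ) T m) (T * A * Tᴴ) := by
  refine IsGaussian.ext ?_ ?_
  · simp only [id]
    rw [ContinuousLinearMap.integral_id_map IsGaussian.integrable_id,
      integral_id_multivariateGaussian, integral_id_multivariateGaussian]
  · ext x y
    rw [covarianceBilin_map IsGaussian.memLp_two_id, covarianceBilin_multivariateGaussian hA,
      covarianceBilin_multivariateGaussian (hA.mul_mul_conjTranspose_same T),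
      ← ContinuousLinearMap.star_eq_adjoint, ← map_star, star_eq_conjTranspose,
      ofLp_toEuclideanCLM, ofLp_toEuclideanCLM, ← mulVec_mulVec, ← mulVec_mulVec,
      dotProduct_mulVec x.ofLp T, conjTranspose_eq_transpose_of_trivial, mulVec_transpose]

lemma multivariateGaussian_diagonal (m : EuclideanSpace ℝ ι) (v : ι → ℝ≥0) :
    multivariateGaussian m (diagonal fun i ↦ (v i : ℝ)) =
      (Measure.pi fun i ↦ gaussianReal (m i) (v i)).map (WithLp.toLp 2) := by
  have hv : (diagonal fun i ↦ (v i : ℝ)).PosSemidef := .diagonal fun i ↦ (v i).coe_nonneg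
  refine Measure.ext_of_charFun (funext fun t ↦ ?_)
  rw [charFun_pi, charFun_multivariateGaussian hv]
  simp_rw [charFun_gaussianReal, ← Complex.exp_sum]
  congr 1
  simp only [dotProduct, mulVec_diagonal, PiLp.inner_apply, Complex.ofReal_sum]
  rw [Finset.sum_mul, Finset.sum_div, ← Finset.sum_sub_distrib]
  refine Finset.sum_congr rfl fun i _ ↦ ?_
  simp only [RCLike.inner_apply, conj_trivial]
  push_cast
  ring

lemma klDiv_multivariateGaussian_diagonal (m₁ m₂ : EuclideanSpace ℝ ι) (v₁ v₂ : ι → ℝ≥0) :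
    klDiv (multivariateGaussian m₁ (diagonal fun i ↦ (v₁ i : ℝ)))
        (multivariateGaussian m₂ (diagonal fun i ↦ (v₂ i : ℝ))) =
      ∑ i, klDiv (gaussianReal (m₁ i) (v₁ i)) (gaussianReal (m₂ i) (v₂ i)) := by
  rw [multivariateGaussian_diagonal, multivariateGaussian_diagonal, ← klDiv_pi]
  exact klDiv_map_measurableEquiv _ _ (MeasurableEquiv.toLp 2 (ι → ℝ))

lemma klDiv_multivariateGaussian_mul_mul_conjTranspose (m₁ m₂ : EuclideanSpace ℝ ι)
    {A B T : Matrix ι ι ℝ} (hA : A.PosSemidef) (hB : B.PosSemidef) (hT : IsUnit T) :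
    klDiv (multivariateGaussian (toEuclideanCLM (𝕜 := ℝ) T m₁) (T * A * Tᴴ))
        (multivariateGaussian (toEuclideanCLM (𝕜 := ℝ) T m₂) (T * B * Tᴴ)) =
      klDiv (multivariateGaussian m₁ A) (multivariateGaussian m₂ B) := by
  obtain ⟨u, hu⟩ := hT.map (toEuclideanCLM (n := ι) (𝕜 := ℝ))
  rw [← map_toEuclideanCLM_multivariateGaussian m₁ hA,
    ← map_toEuclideanCLM_multivariateGaussian m₂ hB, ← hu]
  exact klDiv_map_measurableEquiv _ _
    (ContinuousLinearEquiv.ofUnit u).toHomeomorph.toMeasurableEquiv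

end MultivariateGaussian

section Whitening

open Matrix

lemma isUnit_sqrt {ι : Type*} [Fintype ι] [DecidableEq ι] {B : Matrix ι ι ℝ} (hB : B.PosDef) :
    IsUnit (CFC.sqrt B) :=
  (CFC.isUnit_sqrt_iff B hB.posSemidef.nonneg).2 hB.isUnit

variable {d : ℕ} {A B : Matrix (Fin d) (Fin d) ℝ}

lemma whitened_posSemidef (hA : A.PosSemidef) (B : Matrix (Fin d) (Fin d) ℝ) :
    (whitened A B).PosSemidef := by
  simpa only [whitened, (invSqrt_isHermitian B).eq] using hA.mul_mul_conjTranspose_same (invSqrt B)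

lemma sqrt_mul_whitened_mul_sqrt (A : Matrix (Fin d) (Fin d) ℝ) (hB : B.PosDef) :
    CFC.sqrt B * whitened A B * CFC.sqrt B = A := by
  have hdet := (isUnit_iff_isUnit_det _).1 (isUnit_sqrt hB)
  simp only [whitened, invSqrt, Matrix.mul_assoc]
  rw [nonsing_inv_mul _ hdet, Matrix.mul_one, mul_nonsing_inv_cancel_left _ _ hdet]

lemma exists_isUnit_congr_diagonal_eigenvalues_whitened (hA : A.PosSemidef) (hB : B.PosDef) :
    ∃ T : Matrix (Fin d) (Fin d) ℝ, IsUnit T ∧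
      T * diagonal (whitened_isHermitian hA B).eigenvalues * Tᴴ = A ∧ T * Tᴴ = B := by
  set hC := whitened_isHermitian hA B
  set U : Matrix (Fin d) (Fin d) ℝ := ↑hC.eigenvectorUnitary
  have hUU : U * Uᴴ = 1 := Unitary.coe_mul_star_self hC.eigenvectorUnitary
  have hspec : U * diagonal hC.eigenvalues * Uᴴ = whitened A B := hC.spectral_theorem.symm
  have hsqrt : (CFC.sqrt B)ᴴ = CFC.sqrt B := (CFC.sqrt_nonneg B).isSelfAdjoint
  refine ⟨CFC.sqrt B * U, (isUnit_sqrt hB).mul (.of_mul_eq_one _ hUU), ?_, ?_⟩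
  · calc CFC.sqrt B * U * diagonal hC.eigenvalues * (CFC.sqrt B * U)ᴴ
      _ = CFC.sqrt B * (U * diagonal hC.eigenvalues * Uᴴ) * CFC.sqrt B := by
        simp only [conjTranspose_mul, hsqrt, Matrix.mul_assoc]
      _ = A := by rw [hspec, sqrt_mul_whitened_mul_sqrt A hB]
  · calc CFC.sqrt B * U * (CFC.sqrt B * U)ᴴ
      _ = CFC.sqrt B * (U * Uᴴ) * CFC.sqrt B := by
        simp only [conjTranspose_mul, hsqrt, Matrix.mul_assoc]
      _ = B := by rw [hUU, Matrix.mul_one, CFC.sqrt_mul_sqrt_self B hB.posSemidef.nonneg]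

end Whitening

section Discrepancy

open Matrix

lemma coe_ennreal_sum {ι : Type*} (s : Finset ι) (f : ι → ENNReal) :
    ((∑ i ∈ s, f i : ENNReal) : EReal) = ∑ i ∈ s, (f i : EReal) :=
  map_sum (⟨⟨(↑), EReal.coe_ennreal_zero⟩, EReal.coe_ennreal_add⟩ : ENNReal →+ EReal) f s

lemma sum_h_eq_two_mul_klDiv_multivariateGaussian {ι : Type*} [Fintype ι] [DecidableEq ι]
    (m : EuclideanSpace ℝ ι) {η : ι → ℝ} (hη : ∀ i, 0 ≤ η i) :
    ∑ i, h (η i) = ((2 * klDiv (multivariateGaussian m (diagonal η))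
      (multivariateGaussian m 1) : ENNReal) : EReal) := by
  have hkl := klDiv_multivariateGaussian_diagonal m m (fun i ↦ (η i).toNNReal) 1
  simp only [Real.coe_toNNReal _ (hη _), Pi.one_apply, NNReal.coe_one, diagonal_one] at hkl
  rw [hkl, Finset.mul_sum, coe_ennreal_sum]
  exact Finset.sum_congr rfl fun i _ ↦ h_eq_two_mul_klDiv_gaussianReal (m i) (hη i)

theorem discrepancy_eq_two_mul_klDiv_multivariateGaussian {d : ℕ} (m : EuclideanSpace ℝ (Fin d))
    {A B : Matrix (Fin d) (Fin d) ℝ} (hA : A.PosSemidef) (hB : B.PosDef) :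
    discrepancy A B hA hB =
      ((2 * klDiv (multivariateGaussian m A) (multivariateGaussian m B) : ENNReal) : EReal) := by
  have hη := (whitened_posSemidef hA B).eigenvalues_nonneg
  obtain ⟨T, hT, hTA, hTB⟩ := exists_isUnit_congr_diagonal_eigenvalues_whitened hA hB
  obtain ⟨m', rfl⟩ : ∃ m', toEuclideanCLM (𝕜 := ℝ) T m' = m := by
    refine ⟨toEuclideanCLM (𝕜 := ℝ) T⁻¹ m, ?_⟩
    rw [← mul_apply_eq_comp, ← map_mul, mul_nonsing_inv _ ((isUnit_iff_isUnit_det T).1 hT),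
      map_one, one_apply_eq_self]
  have hkl := klDiv_multivariateGaussian_mul_mul_conjTranspose m' m' (.diagonal hη) .one hT
  rw [hTA, Matrix.mul_one, hTB] at hkl
  rw [hkl]
  exact sum_h_eq_two_mul_klDiv_multivariateGaussian m' hη

end Discrepancy

end ScatterDiscrepancy

open ScatterDiscrepancy in
theorem proposition4_general {d : ℕ} (m : EuclideanSpace ℝ (Fin d))
    (A B : Matrix (Fin d) (Fin d) ℝ) (hA : A.PosSemidef) (hB : B.PosDef)
    {Ω Ω' : Type*} [MeasurableSpace Ω] [MeasurableSpace Ω'] (P : Measure Ω) (P' : Measure Ω')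
    (X : Ω → EuclideanSpace ℝ (Fin d)) (Y : Ω' → EuclideanSpace ℝ (Fin d))
    (hX : HasLaw X (multivariateGaussian m A) P) (hY : HasLaw Y (multivariateGaussian m B) P') :
    discrepancy A B hA hB = ((2 * klDiv (P.map X) (P'.map Y) : ENNReal) : EReal) := by
  rw [hX.map_eq, hY.map_eq]
  exact discrepancy_eq_two_mul_klDiv_multivariateGaussian m hA hB

theorem proposition4 {d : ℕ} (A B : Matrix (Fin d) (Fin d) ℝ) (hA : A.PosDef) (hB : B.PosDef)
    {Ω Ω' : Type*} [MeasurableSpace Ω] [MeasurableSpace Ω'] (P : Measure Ω) (P' : Measure Ω')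
    (X : Ω → EuclideanSpace ℝ (Fin d)) (Y : Ω' → EuclideanSpace ℝ (Fin d))
    (hX : HasLaw X (multivariateGaussian 0 A) P) (hY : HasLaw Y (multivariateGaussian 0 B) P') :
    ScatterDiscrepancy.discrepancy A B hA.posSemidef hB =
      ((2 * klDiv (P.map X) (P'.map Y) : ENNReal) : EReal) :=
  proposition4_general 0 A B hA.posSemidef hB P P' X Y hX hY
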